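/- Let $X_1, X_2, \ldots$ be independent identically distributed real random variables with $\mathbb{E}|X_1|<\infty$, $\mathbb{E}X_1=0$ and $\mathbb{P}(X_1=0)<1$, and for a random variable $S_0$ independent of $(X_n)_{n\ge 1}$ let $S_n=S_0+X_1+\ldots+X_n$. Let $\mathcal{Z}$ be the smallest closed subgroup of $(\mathbb{R},+)$ that contains the topological support of the law of $X_1$, and let $\lambda$ be the normalized Haar measure on $\mathcal{Z}$: Lebesgue measure if $\mathcal{Z}=\mathbb{R}$, and $h$ times the counting measure on $\mathcal{Z}$ if $\mathcal{Z}=h\mathbb{Z}$ with $h>0$. Put $$\pi_+(dx)=\bigl(1-\mathbb{P}(X_1\le x)\bigr)\lambda(dx)\ \text{ on } \mathcal{Z}\cap[0,\infty),\qquad \pi_-(dx)=\bigl(1-\mathbb{P}(X_1> x)\bigr)\lambda(dx)\ \text{ on } \mathcal{Z}\cap(-\infty,0),$$ and $\pi_\pm'=2\pi_\pm/\mathbb{E}|X_1|$. Let $$T^\uparrow=\inf\{k\ge1: S_{k-1}<0,\ S_k\ge0\},\qquad T^\downarrow=\inf\{k\ge1: S_{k-1}\ge0,\ S_k<0\}$$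 be the first up-crossing time and the first down-crossing time of zero (with $\inf\varnothing=\infty$), and for $a\in\mathcal{Z}$ and $n\in\{1,2,\ldots\}\cup\{\infty\}$ let $$L_n^\uparrow(a)=\sum_{0\le i<n}\mathbf{1}(S_i<a,\ S_{i+1}\ge a),\qquad L_n^\downarrow(a)=\sum_{0\le i<n}\mathbf{1}(S_i\ge a,\ S_{i+1}<a)$$ be the numbers of up-crossings and down-crossings of the level $a$ by time $n$. Then $\pi_+'$ and $\pi_-'$ are probability measures, and for every $a\in\mathcal{Z}$ $$\mathbb{E}_{\pi_+'}L^\uparrow_{T^\uparrow}(a)=\mathbb{E}_{\pi_+'}L^\downarrow_{T^\uparrow}(a)=\mathbb{E}_{\pi_-'}L^\uparrow_{T^\downarrow}(a)=\mathbb{E}_{\pi_-'}L^\downarrow_{T^\downarrow}(a)=1,$$ where $\mathbb{E}_\nu$ denotes expectation when $S_0$ has law $\nu$. -/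

import Mathlib

open MeasureTheory ProbabilityTheory Set
open scoped ENNReal

noncomputable section

namespace LevelCrossing

/-- `S 0` for `n = 0`, and the increment `S n - S (n - 1)` for `n ≥ 1`. -/
def startAndIncrements {Ω : Type*} (S : ℕ → Ω → ℝ) : ℕ → Ω → ℝ
  | 0 => S 0
  | n + 1 => fun ω => S (n + 1) ω - S n ω

/-- `S` is a one-dimensional random walk whose increments have the common law `μ`: the increments
`X n = S n - S (n - 1)`, `n ≥ 1`, are independent with law `μ`, the starting point `S 0` is
independent of them; its law is not prescribed. -/
structure IsRandomWalk {Ω : Type*} [MeasurableSpace Ω] (P : Measure Ω) (S : ℕ → Ω → ℝ)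
    (μ : Measure ℝ) : Prop where
  measurable : ∀ n, Measurable (S n)
  indep : iIndepFun (startAndIncrements S) P
  law : ∀ n, P.map (startAndIncrements S (n + 1)) = μ

/-- The state space: the smallest closed subgroup of `ℝ` that contains the topological support of
the law `μ` of the increments. -/
def stateSpace (μ : Measure ℝ) : AddSubgroup ℝ :=
  sInf {Z : AddSubgroup ℝ | IsClosed (Z : Set ℝ) ∧ μ.support ⊆ Z}

/-- The infimum of the positive elements of `Z`. For a closed subgroup `Z ≠ 0` of `ℝ`, either
`span Z = 0` and `Z = ℝ`, or `h = span Z > 0` and `Z = hℤ`. -/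
def span (Z : AddSubgroup ℝ) : ℝ := sInf {z : ℝ | z ∈ Z ∧ 0 < z}

open Classical in
/-- The normalized Haar measure of a closed subgroup `Z ≠ 0` of `ℝ`, as a measure on `ℝ` carried by
`Z`: Lebesgue measure if `Z = ℝ`, and `h` times the counting measure on `Z` if `Z = hℤ`, `h > 0`. -/
def haar (Z : AddSubgroup ℝ) : Measure ℝ :=
  if span Z = 0 then volume
  else ENNReal.ofReal (span Z) • Measure.count.restrict (Z : Set ℝ)

/-- `π₊(dx) = (1 - ℙ(X₁ ≤ x)) λ(dx)` on the non-negative part of the state space. -/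
def piPlus (μ : Measure ℝ) : Measure ℝ :=
  ((haar (stateSpace μ)).restrict (Ici 0)).withDensity fun x => 1 - μ (Iic x)

/-- `π₋(dx) = (1 - ℙ(X₁ > x)) λ(dx)` on the negative part of the state space. -/
def piMinus (μ : Measure ℝ) : Measure ℝ :=
  ((haar (stateSpace μ)).restrict (Iio 0)).withDensity fun x => 1 - μ (Ioi x)

/-- `π₊' = 2 π₊ / 𝔼|X₁|`. -/
def piPlusNorm (μ : Measure ℝ) : Measure ℝ :=
  ENNReal.ofReal (2 / ∫ x, |x| ∂μ) • piPlus μ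

/-- `π₋' = 2 π₋ / 𝔼|X₁|`. -/
def piMinusNorm (μ : Measure ℝ) : Measure ℝ :=
  ENNReal.ofReal (2 / ∫ x, |x| ∂μ) • piMinus μ

/-- The first up-crossing time of zero by the trajectory `s` (`⊤` if there is none). -/
def firstUp (s : ℕ → ℝ) : ℕ∞ :=
  ⨅ (k : ℕ) (_ : 1 ≤ k ∧ s (k - 1) < 0 ∧ 0 ≤ s k), (k : ℕ∞)

/-- The first down-crossing time of zero by the trajectory `s` (`⊤` if there is none). -/
def firstDown (s : ℕ → ℝ) : ℕ∞ :=
  ⨅ (k : ℕ) (_ : 1 ≤ k ∧ 0 ≤ s (k - 1) ∧ s k < 0), (k : ℕ∞)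

open Classical in
/-- The number of up-crossings of the level `a` by time `n`, that is, the number of `i` with
`0 ≤ i ≤ n - 1`, `s i < a` and `s (i + 1) ≥ a`. -/
def upCrossings (s : ℕ → ℝ) (n : ℕ∞) (a : ℝ) : ℝ≥0∞ :=
  ∑' i : ℕ, if (i : ℕ∞) < n ∧ s i < a ∧ a ≤ s (i + 1) then 1 else 0

open Classical in
/-- The number of down-crossings of the level `a` by time `n`, that is, the number of `i` with
`0 ≤ i ≤ n - 1`, `s i ≥ a` and `s (i + 1) < a`. -/
def downCrossings (s : ℕ → ℝ) (n : ℕ∞) (a : ℝ) : ℝ≥0∞ :=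
  ∑' i : ℕ, if (i : ℕ∞) < n ∧ a ≤ s i ∧ s (i + 1) < a then 1 else 0

end LevelCrossing

end

noncomputable section

namespace LevelCrossing

open Filter Topology

/-! Let `A` be `Iio 0` (or `Ici 0`) and kill the walk when it jumps from `A` to `Aᶜ`. The law `π₊`
(or `π₋`) has, with respect to the Haar measure `λ` of the state space, the density "probability
that one step of the reversed walk goes from `x ∉ A` into `A`" (`killingRev`).

Since `λ` is translation invariant, the killed step and the killed reversed step are dual with
respect to `λ`. Hence the occupation measure of the killed walk started from this density has at `x`
the density "probability that the reversed walk from `x` ever jumps from `Aᶜ` to `A`". That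
probability is 1, so the occupation measure is `λ` itself (`tsum_lintegral_killedStep_iterate`).

The expected number of crossings of `a` before killing is therefore the `λ`-flow across `a` in one
step. For an up-crossing with increment `z` it is `λ [a - z, a) = z⁺`, which integrates to `𝔼 X⁺ =
𝔼|X| / 2`; down-crossings give `𝔼 X⁻`, which is the same. The normalization turns both into 1, for
every `a` in the state space.

That the reversed walk is killed almost surely is recurrence in disguise. It is derived from a
Liouville property (`eq_zero_of_le_step`): a bounded subharmonic function vanishing on a half-line
is zero. Passing to running suprema makes the function monotone; integrating its one-step gain over
an interval leaves boundary terms that vanish at `±∞` because the mean is zero, so it is harmonic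
almost everywhere, and its zero set then spreads to the right. -/

/-! ### A Liouville property of centred random walks -/

theorem exists_pos_measure_Ici (ν : Measure ℝ) [IsProbabilityMeasure ν] (hnd : ν ≠ Measure.dirac 0)
    (hint : Integrable (fun x : ℝ => x) ν) (hmean : ∫ x, x ∂ν = 0) :
    ∃ δ : ℝ, 0 < δ ∧ 0 < ν (Ici δ) := by
  by_contra! h
  have h1 : ∀ᵐ z ∂ν, z ≤ 0 := by
    have : ∀ n : ℕ, ∀ᵐ z ∂ν, z < 1 / ((n : ℝ) + 1) := by
      intro n
      have h2 := le_antisymm (h (1 / ((n : ℝ) + 1)) (by positivity)) zero_le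
      rw [ae_iff]
      simpa [Ici] using h2
    filter_upwards [ae_all_iff.2 this] with z hz
    by_contra! hz0
    obtain ⟨n, hn⟩ := exists_nat_one_div_lt hz0
    exact absurd (hz n) (not_lt.2 hn.le)
  have h2 : (fun z : ℝ => -z) =ᵐ[ν] 0 := by
    refine (integral_eq_zero_iff_of_nonneg_ae ?_ hint.neg).1 (by
      simp only [Pi.neg_apply]
      rw [integral_neg, hmean, neg_zero])
    filter_upwards [h1] with z hz
    simpa using hz
  have h3 : (id : ℝ → ℝ) =ᵐ[ν] fun _ => 0 := by
    filter_upwards [h2] with z hz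
    simpa using hz
  have h4 : ν.map id = ν.map fun _ => (0 : ℝ) := Measure.map_congr h3
  rw [Measure.map_id, Measure.map_const, measure_univ, one_smul] at h4
  exact hnd h4

theorem integrable_of_abs_le_one {α : Type*} [MeasurableSpace α] {ν : Measure α}
    [IsFiniteMeasure ν] {f : α → ℝ} (hf : Measurable f) (h : ∀ x, |f x| ≤ 1) : Integrable f ν :=
  Integrable.of_bound hf.aestronglyMeasurable 1 (ae_of_all _ h)

theorem intervalIntegrable_of_abs_le_one {f : ℝ → ℝ} (hf : Measurable f) (h : ∀ x, |f x| ≤ 1)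
    (a b : ℝ) : IntervalIntegrable f volume a b :=
  ⟨integrable_of_abs_le_one hf h, integrable_of_abs_le_one hf h⟩

/-- The expected increment of a primitive of `r` over one step of the walk started at `N`. -/
def drift (ν : Measure ℝ) (r : ℝ → ℝ) (N : ℝ) : ℝ := ∫ z, (∫ y in (0 : ℝ)..z, r (N + y)) ∂ν

theorem abs_intervalIntegral_le {r : ℝ → ℝ} (h : ∀ x, |r x| ≤ 1) (N z : ℝ) :
    ‖∫ y in (0 : ℝ)..z, r (N + y)‖ ≤ |z| := by
  simpa using intervalIntegral.norm_integral_le_of_norm_le_const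
    (C := 1) (a := 0) (b := z) (f := fun y => r (N + y)) (fun x _ => h _)

theorem continuous_intervalIntegral {r : ℝ → ℝ} (hr : Measurable r) (h : ∀ x, |r x| ≤ 1) (N : ℝ) :
    Continuous fun z => ∫ y in (0 : ℝ)..z, r (N + y) :=
  intervalIntegral.continuous_primitive (fun a b => intervalIntegrable_of_abs_le_one
    (f := fun y => r (N + y)) (by fun_prop) (fun x => h _) a b) 0

/-- Far out `r` looks like the constant `c`, so the inner integral tends to `z * c`, dominated by
`|z|`; the mean of `z * c` is zero. -/
theorem tendsto_drift {ν : Measure ℝ} (hint : Integrable (fun x : ℝ => x) ν)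
    (hmean : ∫ x, x ∂ν = 0) {r : ℝ → ℝ} (hr : Measurable r) (h : ∀ x, |r x| ≤ 1)
    {l : Filter ℝ} [l.IsCountablyGenerated] {c : ℝ}
    (hl : ∀ y : ℝ, Tendsto (fun N => r (N + y)) l (𝓝 c)) :
    Tendsto (drift ν r) l (𝓝 0) := by
  have h1 : ∀ z : ℝ, Tendsto (fun N => ∫ y in (0 : ℝ)..z, r (N + y)) l (𝓝 (z * c)) := by
    intro z
    have := intervalIntegral.tendsto_integral_filter_of_dominated_convergence
      (μ := volume) (a := 0) (b := z) (F := fun N y => r (N + y)) (f := fun _ => c) (l := l)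
      (fun _ => 1) (Eventually.of_forall fun N => by
        exact (hr.comp (measurable_const_add N)).aestronglyMeasurable)
      (Eventually.of_forall fun N => ae_of_all _ fun y _ => h _) (by simp)
      (ae_of_all _ fun y _ => hl y)
    simpa using this
  have h2 := tendsto_integral_filter_of_dominated_convergence (μ := ν)
    (F := fun N z => ∫ y in (0 : ℝ)..z, r (N + y)) (f := fun z => z * c) (l := l) (fun z => |z|)
    (Eventually.of_forall fun N =>
      (continuous_intervalIntegral hr h N).aestronglyMeasurable)
    (Eventually.of_forall fun N => ae_of_all _ fun z => abs_intervalIntegral_le h N z) hint.abs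
    (ae_of_all _ h1)
  rwa [integral_mul_const, hmean, zero_mul] at h2

/-- By Fubini, fix `z` first: the integrals of `r` over `(a + z, b + z]` and `(a, b]` differ only by
boundary pieces of length `|z|` at `b` and at `a`. -/
theorem setIntegral_step_sub {ν : Measure ℝ} [IsProbabilityMeasure ν]
    (hint : Integrable (fun x : ℝ => x) ν) {r : ℝ → ℝ} (hr : Measurable r) (h : ∀ x, |r x| ≤ 1)
    {a b : ℝ} (hab : a ≤ b) :
    ∫ x in Ioc a b, ((∫ z, r (x + z) ∂ν) - r x) = drift ν r b - drift ν r a := by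
  have hI : ∀ u v : ℝ, IntervalIntegrable r volume u v := intervalIntegrable_of_abs_le_one hr h
  have hF : Integrable (Function.uncurry fun x z : ℝ => r (x + z) - r x)
      ((volume.restrict (Ioc a b)).prod ν) := by
    refine Integrable.of_bound (C := 2) ?_ (ae_of_all _ ?_)
    · exact ((hr.comp (measurable_fst.add measurable_snd)).sub
        (hr.comp measurable_fst)).aestronglyMeasurable
    · rintro ⟨x, z⟩
      have := abs_sub (r (x + z)) (r x)
      have := h x
      have := h (x + z)
      simp only [Function.uncurry, Real.norm_eq_abs]
      linarith
  have hD : ∀ N, Integrable (fun z => ∫ y in (0 : ℝ)..z, r (N + y)) ν := fun N =>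
    hint.abs.mono' (continuous_intervalIntegral hr h N).aestronglyMeasurable
      (ae_of_all _ fun z => abs_intervalIntegral_le h N z)
  calc ∫ x in Ioc a b, ((∫ z, r (x + z) ∂ν) - r x)
      = ∫ x in Ioc a b, ∫ z, (r (x + z) - r x) ∂ν := by
        refine integral_congr_ae (ae_of_all _ fun x => ?_)
        simp only
        rw [integral_sub (integrable_of_abs_le_one (by fun_prop) fun z => h _) (by simp)]
        simp
    _ = ∫ z, (∫ x in Ioc a b, (r (x + z) - r x)) ∂ν := integral_integral_swap hF
    _ = ∫ z, ((∫ y in (0 : ℝ)..z, r (b + y)) - ∫ y in (0 : ℝ)..z, r (a + y)) ∂ν := by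
        refine integral_congr_ae (ae_of_all _ fun z => ?_)
        simp only
        rw [← intervalIntegral.integral_of_le hab, intervalIntegral.integral_sub
          (intervalIntegrable_of_abs_le_one (by fun_prop) (fun x => h _) _ _) (hI _ _),
          intervalIntegral.integral_comp_add_right, intervalIntegral.integral_comp_add_left,
          intervalIntegral.integral_comp_add_left, add_zero, add_zero]
        have e1 := intervalIntegral.integral_add_adjacent_intervals (hI a b) (hI b (b + z))
        have e2 := intervalIntegral.integral_add_adjacent_intervals (hI a (a + z))
          (hI (a + z) (b + z))
        linarith
    _ = drift ν r b - drift ν r a := integral_sub (hD b) (hD a)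

/-- A bounded nondecreasing subharmonic function of a centred random walk is harmonic almost
everywhere. -/
theorem ae_eq_step_of_monotone {ν : Measure ℝ} [IsProbabilityMeasure ν]
    (hint : Integrable (fun x : ℝ => x) ν) (hmean : ∫ x, x ∂ν = 0) {r : ℝ → ℝ} (hr : Monotone r)
    (h : ∀ x, |r x| ≤ 1) (hsub : ∀ x, r x ≤ ∫ z, r (x + z) ∂ν) :
    ∀ᵐ x, r x = ∫ z, r (x + z) ∂ν := by
  have hrm := hr.measurable
  have hstep : Measurable fun x => ∫ z, r (x + z) ∂ν :=
    (StronglyMeasurable.integral_prod_right' (ν := ν) (f := fun p : ℝ × ℝ => r (p.1 + p.2))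
      (hrm.comp (measurable_fst.add measurable_snd)).stronglyMeasurable).measurable
  have hstep1 : ∀ x, |∫ z, r (x + z) ∂ν| ≤ 1 := fun x => by
    simpa using norm_integral_le_of_norm_le_const (μ := ν) (f := fun z => r (x + z)) (C := 1)
      (ae_of_all _ fun z => h (x + z))
  -- Subharmonicity makes the drift nondecreasing; with limit 0 at both ends it must vanish
  -- identically.
  have hmono : Monotone (drift ν r) := fun a b hab => by
    rw [← sub_nonneg, ← setIntegral_step_sub hint hrm h hab]
    exact integral_nonneg fun x => sub_nonneg.2 (hsub x)
  have hbdd : BddAbove (range r) := ⟨1, by rintro _ ⟨x, rfl⟩; exact (abs_le.1 (h x)).2⟩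
  have hbdd' : BddBelow (range r) := ⟨-1, by rintro _ ⟨x, rfl⟩; exact (abs_le.1 (h x)).1⟩
  have htop : Tendsto (drift ν r) atTop (𝓝 0) := tendsto_drift hint hmean hrm h fun y =>
    (tendsto_atTop_ciSup hr hbdd).comp (tendsto_atTop_add_const_right _ y tendsto_id)
  have hbot : Tendsto (drift ν r) atBot (𝓝 0) := tendsto_drift hint hmean hrm h fun y =>
    (tendsto_atBot_ciInf hr hbdd').comp (tendsto_atBot_add_const_right _ y tendsto_id)
  have hzero : ∀ N, drift ν r N = 0 := fun N =>
    le_antisymm (hmono.ge_of_tendsto htop N) (hmono.le_of_tendsto hbot N)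
  have key : ∀ n : ℕ, ∀ᵐ x, x ∈ Ioc (-(n : ℝ)) n → r x = ∫ z, r (x + z) ∂ν := by
    intro n
    rw [← ae_restrict_iff' measurableSet_Ioc]
    have h0 := setIntegral_step_sub hint hrm h (show -(n : ℝ) ≤ n by linarith [n.cast_nonneg (α := ℝ)])
    rw [hzero, hzero, sub_zero, integral_eq_zero_iff_of_nonneg (fun x => sub_nonneg.2 (hsub x))
      ((integrable_of_abs_le_one hstep hstep1).sub (integrable_of_abs_le_one hrm h))] at h0
    filter_upwards [h0] with x hx
    simp only [Pi.zero_apply] at hx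
    linarith
  filter_upwards [ae_all_iff.2 key] with x hx
  obtain ⟨n, hn⟩ := exists_nat_gt |x|
  have := abs_lt.1 hn
  exact hx n ⟨this.1, this.2.le⟩

/-- Upward jumps of size at least `δ` have positive probability, so harmonicity at a zero `w` of `r`
forces zeros up to `w + δ`; the zero half-line grows by `δ` at each induction step. -/
theorem eq_zero_of_monotone_of_le_step {ν : Measure ℝ} [IsProbabilityMeasure ν]
    (hnd : ν ≠ Measure.dirac 0)
    (hint : Integrable (fun x : ℝ => x) ν) (hmean : ∫ x, x ∂ν = 0) {r : ℝ → ℝ} (hr : Monotone r)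
    (h0 : ∀ x, 0 ≤ r x) (h1 : ∀ x, r x ≤ 1) (hneg : ∀ x < 0, r x = 0)
    (hsub : ∀ x, r x ≤ ∫ z, r (x + z) ∂ν) (x : ℝ) : r x = 0 := by
  have hrm := hr.measurable
  have h : ∀ x, |r x| ≤ 1 := fun x => by rw [abs_of_nonneg (h0 x)]; exact h1 x
  obtain ⟨δ, hδ, hνδ⟩ := exists_pos_measure_Ici ν hnd hint hmean
  have hae := ae_eq_step_of_monotone hint hmean hr h hsub
  have key : ∀ n : ℕ, ∀ x < n * δ, r x = 0 := by
    intro n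
    induction n with
    | zero => simpa using hneg
    | succ n ih =>
      intro x hx
      push_cast at hx
      by_contra hne
      have hpos : 0 < r x := lt_of_le_of_ne (h0 x) (Ne.symm hne)
      -- Harmonicity holds only almost everywhere, so `w` is picked from an interval of positive
      -- length on which `r` already vanishes and from which a jump of size `δ` passes `x`.
      have hvol : (volume (Ioo (x - δ) (n * δ))) ≠ 0 := by
        rw [Real.volume_Ioo]
        simp only [ne_eq, ENNReal.ofReal_eq_zero, not_le]
        linarith
      obtain ⟨w, hw, hw'⟩ := (frequently_ae_mem_iff.2 hvol).and_eventually hae |>.exists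
      rw [ih w hw.2] at hw'
      have hle : r x * ν.real (Ici δ) ≤ ∫ z, r (w + z) ∂ν := by
        have : ∫ z, (Ici δ).indicator (fun _ => r x) z ∂ν = r x * ν.real (Ici δ) := by
          rw [integral_indicator_const _ measurableSet_Ici, smul_eq_mul, mul_comm]
        rw [← this]
        refine integral_mono ((integrable_const _).indicator measurableSet_Ici)
          (integrable_of_abs_le_one (by fun_prop) fun z => h _) fun z => ?_
        by_cases hz : z ∈ Ici δ
        · rw [indicator_of_mem hz]
          have : δ ≤ z := hz
          exact hr (by linarith [hw.1])
        · rw [indicator_of_notMem hz]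
          exact h0 _
      have : 0 < r x * ν.real (Ici δ) :=
        mul_pos hpos (ENNReal.toReal_pos hνδ.ne' (measure_ne_top _ _))
      linarith
  obtain ⟨n, hn⟩ := exists_nat_gt (x / δ)
  exact key n x ((div_lt_iff₀ hδ).1 hn)

/-- A bounded subharmonic function of a centred non-degenerate random walk vanishes if it vanishes
on a half-line. -/
theorem eq_zero_of_le_step {ν : Measure ℝ} [IsProbabilityMeasure ν] (hnd : ν ≠ Measure.dirac 0)
    (hint : Integrable (fun x : ℝ => x) ν) (hmean : ∫ x, x ∂ν = 0) {f : ℝ → ℝ≥0∞}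
    (h1 : ∀ x, f x ≤ 1) (hneg : ∀ x < 0, f x = 0) (hsub : ∀ x, f x ≤ ∫⁻ z, f (x + z) ∂ν) (x : ℝ) :
    f x = 0 := by
  -- The running supremum stays subharmonic because the walk is translation invariant. Being
  -- monotone it is also measurable, which is not assumed of `f`.
  let F : ℝ → ℝ≥0∞ := fun x => ⨆ y : Iic x, f y
  have hfF : ∀ {y x : ℝ}, y ≤ x → f y ≤ F x := fun {y x} hyx =>
    le_iSup (fun y : Iic x => f y) ⟨y, hyx⟩
  have hF1 : ∀ x, F x ≤ 1 := fun x => iSup_le fun y => h1 y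
  have hFm : Monotone F := fun a b hab => iSup_le fun y => hfF (le_trans y.2 hab)
  have hFneg : ∀ x < 0, F x = 0 := fun x hx => by
    refine le_antisymm (iSup_le fun y => (hneg y (lt_of_le_of_lt y.2 hx)).le) zero_le
  have hFsub : ∀ x, F x ≤ ∫⁻ z, F (x + z) ∂ν := fun x => iSup_le fun y =>
    (hsub y).trans (lintegral_mono fun z => hfF (by have : (y : ℝ) ≤ x := y.2; linarith))
  have hFtop : ∀ x, F x ≠ ∞ := fun x => ((hF1 x).trans_lt ENNReal.one_lt_top).ne
  have hr := eq_zero_of_monotone_of_le_step hnd hint hmean (r := fun x => (F x).toReal)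
    (fun a b hab => ENNReal.toReal_mono (hFtop b) (hFm hab)) (fun x => ENNReal.toReal_nonneg)
    (fun x => ENNReal.toReal_le_of_le_ofReal zero_le_one (by simpa using hF1 x))
    (fun x hx => by simp [hFneg x hx])
    (fun x => by
      rw [integral_toReal (f := fun z => F (x + z))
        ((hFm.measurable.comp (measurable_const_add x)).aemeasurable)
        (ae_of_all _ fun z => (hFtop _).lt_top)]
      refine ENNReal.toReal_mono ?_ (hFsub x)
      refine ((lintegral_mono fun z => hF1 (x + z)).trans_lt ?_).ne
      simp) x
  have hFx : F x = 0 := by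
    rcases (ENNReal.toReal_eq_zero_iff _).1 hr with h | h
    · exact h
    · exact absurd h (hFtop x)
  exact le_antisymm ((hfF le_rfl).trans hFx.le) zero_le

/-! ### The state space and its Haar measure -/

theorem ae_mem_stateSpace (μ : Measure ℝ) : ∀ᵐ z ∂μ, z ∈ stateSpace μ := by
  filter_upwards [Measure.support_mem_ae (μ := μ)] with z hz
  rw [stateSpace, AddSubgroup.mem_sInf]
  exact fun Z hZ => hZ.2 hz

/-- A subgroup of `ℝ` that misses an interval `(0, ε)` has a least positive element, which generates
it; closedness is not needed. -/
theorem eq_zmultiples_of_span_ne_zero {Z : AddSubgroup ℝ} (hZ : span Z ≠ 0) :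
    0 < span Z ∧ Z = AddSubgroup.zmultiples (span Z) := by
  have hbdd : BddBelow {z : ℝ | z ∈ Z ∧ 0 < z} := ⟨0, fun z hz => hz.2.le⟩
  have hpos : 0 < span Z :=
    lt_of_le_of_ne (Real.sInf_nonneg fun z hz => hz.2.le) (Ne.symm hZ)
  refine ⟨hpos, ?_⟩
  have hne : {z : ℝ | z ∈ Z ∧ 0 < z}.Nonempty := by
    by_contra h
    rw [not_nonempty_iff_eq_empty] at h
    exact hZ (by rw [span, h, Real.sInf_empty])
  have hbot : Z ≠ ⊥ := by
    rintro rfl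
    obtain ⟨z, hz, hz0⟩ := hne
    rw [AddSubgroup.mem_bot] at hz
    exact hz0.ne' hz
  have hd : Disjoint (Z : Set ℝ) (Ioo 0 (span Z)) := by
    rw [Set.disjoint_left]
    exact fun z hz hz' => absurd (csInf_le hbdd ⟨hz, hz'.1⟩) (not_le.2 hz'.2)
  obtain ⟨b, hb⟩ := AddSubgroup.exists_isLeast_pos hbot hpos hd
  rw [AddSubgroup.zmultiples_eq_closure]
  have : span Z = b := hb.csInf_eq
  rw [this]
  exact AddSubgroup.cyclic_of_min hb

/-- The normalized Haar measure of `hℤ`. -/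
def latticeMeasure (h : ℝ) : Measure ℝ :=
  ENNReal.ofReal h • Measure.sum fun k : ℤ => Measure.dirac ((k : ℝ) * h)

theorem lintegral_latticeMeasure (h : ℝ) {f : ℝ → ℝ≥0∞} (hf : Measurable f) :
    ∫⁻ x, f x ∂(latticeMeasure h) = ENNReal.ofReal h * ∑' k : ℤ, f (k * h) := by
  simp only [latticeMeasure, lintegral_smul_measure, lintegral_sum_measure, lintegral_dirac' _ hf,
    smul_eq_mul]

theorem haar_eq_latticeMeasure {Z : AddSubgroup ℝ} (hZ : span Z ≠ 0) :
    haar Z = latticeMeasure (span Z) := by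
  obtain ⟨hpos, hmul⟩ := eq_zmultiples_of_span_ne_zero hZ
  rw [haar, if_neg hZ, latticeMeasure]
  congr 1
  set h := span Z
  have hinj : Function.Injective fun k : ℤ => (k : ℝ) * h := fun a b hab => by
    simpa [hpos.ne'] using hab
  ext s hs
  have hZm : MeasurableSet (Z : Set ℝ) := by
    rw [hmul]
    exact (Set.countable_range _).measurableSet
  rw [Measure.restrict_apply hs, Measure.sum_apply _ hs, ← lintegral_indicator_one (hs.inter hZm),
    lintegral_count, ← hinj.tsum_eq]
  · refine tsum_congr fun k => ?_
    have hk : (k : ℝ) * h ∈ Z := by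
      rw [hmul]; exact ⟨k, by simp⟩
    rw [Measure.dirac_apply' _ hs]
    by_cases hks : (k : ℝ) * h ∈ s
    · simp [hks, hk]
    · simp [hks]
  · intro x hx
    have hxZ : x ∈ Z := by
      by_contra hxZ
      exact hx (indicator_of_notMem (fun h' => hxZ h'.2) _)
    rw [hmul] at hxZ
    obtain ⟨k, hk⟩ := hxZ
    exact ⟨k, by simpa using hk⟩

instance sFinite_haar (Z : AddSubgroup ℝ) : SFinite (haar Z) := by
  by_cases hZ : span Z = 0
  · rw [haar, if_pos hZ]
    infer_instance
  · rw [haar_eq_latticeMeasure hZ, latticeMeasure]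
    infer_instance

theorem lintegral_haar_add_right {Z : AddSubgroup ℝ} {z : ℝ} (hz : z ∈ Z) {f : ℝ → ℝ≥0∞}
    (hf : Measurable f) : ∫⁻ x, f (x + z) ∂(haar Z) = ∫⁻ x, f x ∂(haar Z) := by
  by_cases hZ : span Z = 0
  · rw [haar, if_pos hZ]
    exact lintegral_add_right_eq_self f z
  · rw [haar_eq_latticeMeasure hZ, lintegral_latticeMeasure _ hf,
      lintegral_latticeMeasure _ (by fun_prop)]
    rw [(eq_zmultiples_of_span_ne_zero hZ).2] at hz
    obtain ⟨m, rfl⟩ := hz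
    congr 1
    rw [← (Equiv.addRight m).tsum_eq fun k : ℤ => f (k * span Z)]
    refine tsum_congr fun k => ?_
    simp [add_mul]

/-- In the lattice case, a half-open interval with endpoints in `hℤ` contains exactly `(c - b) / h`
lattice points if `b ≤ c`. This is why the level `a` must lie in the state space. -/
theorem haar_Ico {Z : AddSubgroup ℝ} {b c : ℝ} (hb : b ∈ Z) (hc : c ∈ Z) :
    haar Z (Ico b c) = ENNReal.ofReal (c - b) := by
  by_cases hZ : span Z = 0
  · rw [haar, if_pos hZ, Real.volume_Ico]
  · obtain ⟨hpos, hmul⟩ := eq_zmultiples_of_span_ne_zero hZ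
    rw [← lintegral_indicator_one measurableSet_Ico, haar_eq_latticeMeasure hZ,
      lintegral_latticeMeasure _ (measurable_one.indicator measurableSet_Ico)]
    rw [hmul] at hb hc
    obtain ⟨m, rfl⟩ := hb
    obtain ⟨n, rfl⟩ := hc
    have : ∀ k : ℤ, (Ico (m • span Z) (n • span Z)).indicator (1 : ℝ → ℝ≥0∞) (k * span Z)
        = if k ∈ Finset.Ico m n then 1 else 0 := by
      intro k
      simp [indicator_apply, zsmul_eq_mul, hpos]
    simp only [this]
    rw [tsum_eq_sum (s := Finset.Ico m n) (fun k hk => if_neg hk), Finset.sum_ite_mem,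
      Finset.inter_self, Finset.sum_const, Int.card_Ico, nsmul_eq_mul, mul_one]
    rw [← ENNReal.ofReal_natCast, ← ENNReal.ofReal_mul hpos.le]
    simp only [zsmul_eq_mul]
    rcases le_total m n with hmn | hmn
    · have : (((n - m).toNat : ℕ) : ℝ) = n - m := by
        have := Int.toNat_of_nonneg (sub_nonneg.2 hmn)
        exact_mod_cast this
      rw [this]
      congr 1
      ring
    · rw [Int.toNat_of_nonpos (by omega), Nat.cast_zero, mul_zero, ENNReal.ofReal_zero,
        ENNReal.ofReal_of_nonpos]
      rw [← sub_mul]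
      exact mul_nonpos_of_nonpos_of_nonneg (by simpa using hmn) hpos.le

/-! ### The killed walk and its time reversal -/

open Classical in
/-- One step of the walk with increment law `μ`, killed when it jumps from `A` to `Aᶜ`. -/
def killedStep (μ : Measure ℝ) (A : Set ℝ) (f : ℝ → ℝ≥0∞) (x : ℝ) : ℝ≥0∞ :=
  ∫⁻ z, (if x ∈ A ∧ x + z ∉ A then 0 else f (x + z)) ∂μ

open Classical in
/-- One step of the time-reversed walk, killed when it jumps from `Aᶜ` to `A`. -/
def killedStepRev (μ : Measure ℝ) (A : Set ℝ) (f : ℝ → ℝ≥0∞) (x : ℝ) : ℝ≥0∞ :=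
  ∫⁻ z, (if x - z ∈ A ∧ x ∉ A then 0 else f (x - z)) ∂μ

open Classical in
/-- The probability that the time-reversed walk jumps from `x ∉ A` to `A` in one step. -/
def killingRev (μ : Measure ℝ) (A : Set ℝ) (x : ℝ) : ℝ≥0∞ :=
  ∫⁻ z, (if x - z ∈ A ∧ x ∉ A then 1 else 0) ∂μ

section Operators

variable {μ : Measure ℝ} {A : Set ℝ}

theorem measurable_killedStep_integrand (hA : MeasurableSet A) {f : ℝ → ℝ≥0∞} (hf : Measurable f)
    [DecidablePred fun p : ℝ × ℝ => p.1 ∈ A ∧ p.1 + p.2 ∉ A] :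
    Measurable fun p : ℝ × ℝ => if p.1 ∈ A ∧ p.1 + p.2 ∉ A then 0 else f (p.1 + p.2) :=
  Measurable.ite ((measurable_fst hA).inter ((measurable_fst.add measurable_snd) hA).compl)
    measurable_const (hf.comp (measurable_fst.add measurable_snd))

theorem measurableSet_killing (hA : MeasurableSet A) :
    MeasurableSet {p : ℝ × ℝ | p.1 - p.2 ∈ A ∧ p.1 ∉ A} :=
  ((measurable_fst.sub measurable_snd) hA).inter (measurable_fst hA).compl

theorem measurable_killedStepRev_integrand (hA : MeasurableSet A) {f : ℝ → ℝ≥0∞}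
    (hf : Measurable f) [DecidablePred fun p : ℝ × ℝ => p.1 - p.2 ∈ A ∧ p.1 ∉ A] :
    Measurable fun p : ℝ × ℝ => if p.1 - p.2 ∈ A ∧ p.1 ∉ A then 0 else f (p.1 - p.2) :=
  Measurable.ite (measurableSet_killing hA) measurable_const
    (hf.comp (measurable_fst.sub measurable_snd))

theorem measurable_killedStep [SFinite μ] (hA : MeasurableSet A) {f : ℝ → ℝ≥0∞}
    (hf : Measurable f) : Measurable (killedStep μ A f) := by
  classical
  exact (measurable_killedStep_integrand hA hf).lintegral_prod_right'

theorem measurable_killedStepRev [SFinite μ] (hA : MeasurableSet A) {f : ℝ → ℝ≥0∞}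
    (hf : Measurable f) : Measurable (killedStepRev μ A f) := by
  classical
  exact (measurable_killedStepRev_integrand hA hf).lintegral_prod_right'

theorem measurable_killingRev [SFinite μ] (hA : MeasurableSet A) :
    Measurable (killingRev μ A) := by
  classical
  exact (Measurable.ite (measurableSet_killing hA) measurable_const
    measurable_const).lintegral_prod_right'

theorem measurable_killedStepRev_iterate [SFinite μ] (hA : MeasurableSet A) {f : ℝ → ℝ≥0∞}
    (hf : Measurable f) (n : ℕ) : Measurable ((killedStepRev μ A)^[n] f) := by
  induction n with
  | zero => exact hf
  | succ n ih => rw [Function.iterate_succ_apply']; exact measurable_killedStepRev hA ih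

theorem measurable_killedStep_iterate [SFinite μ] (hA : MeasurableSet A) {f : ℝ → ℝ≥0∞}
    (hf : Measurable f) (n : ℕ) : Measurable ((killedStep μ A)^[n] f) := by
  induction n with
  | zero => exact hf
  | succ n ih => rw [Function.iterate_succ_apply']; exact measurable_killedStep hA ih

theorem monotone_killedStepRev : Monotone (killedStepRev μ A) := fun f g hfg x =>
  lintegral_mono fun z => by split_ifs <;> [exact le_rfl; exact hfg _]

theorem killedStepRev_iterate_add [SFinite μ] (hA : MeasurableSet A) {f g : ℝ → ℝ≥0∞}
    (hf : Measurable f) (n : ℕ) :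
    (killedStepRev μ A)^[n] (f + g) = (killedStepRev μ A)^[n] f + (killedStepRev μ A)^[n] g := by
  classical
  induction n with
  | zero => rfl
  | succ n ih =>
    rw [Function.iterate_succ_apply', ih, Function.iterate_succ_apply',
      Function.iterate_succ_apply']
    ext x
    have hm : Measurable fun z => if x - z ∈ A ∧ x ∉ A then 0
        else (killedStepRev μ A)^[n] f (x - z) := (measurable_killedStepRev_integrand hA
      (measurable_killedStepRev_iterate (μ := μ) hA hf n)).comp (measurable_prodMk_left (x := x))
    simp only [killedStepRev, Pi.add_apply]
    rw [← lintegral_add_left hm]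
    refine lintegral_congr fun z => ?_
    split_ifs <;> simp

theorem killingRev_add_killedStepRev_one [IsProbabilityMeasure μ] (hA : MeasurableSet A) :
    killingRev μ A + killedStepRev μ A 1 = 1 := by
  classical
  ext x
  have hm : Measurable fun z => if x - z ∈ A ∧ x ∉ A then (1 : ℝ≥0∞) else 0 :=
    (Measurable.ite (measurableSet_killing hA) measurable_const measurable_const).comp
      (measurable_prodMk_left (x := x))
  simp only [killingRev, killedStepRev, Pi.add_apply, Pi.one_apply]
  rw [← lintegral_add_left hm]
  have : ∀ z, ((if x - z ∈ A ∧ x ∉ A then (1 : ℝ≥0∞) else 0) +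
      if x - z ∈ A ∧ x ∉ A then 0 else 1) = 1 := fun z => by split_ifs <;> simp
  simp [this]

/-- The reversed walk is either killed at one of its first `n` steps or survives them all. -/
theorem sum_killedStepRev_iterate_add [IsProbabilityMeasure μ] (hA : MeasurableSet A) (n : ℕ) :
    (∑ i ∈ Finset.range n, (killedStepRev μ A)^[i] (killingRev μ A)) +
      (killedStepRev μ A)^[n] 1 = 1 := by
  induction n with
  | zero => simp
  | succ n ih =>
    rw [Finset.sum_range_succ, add_assoc, Function.iterate_succ_apply,
      ← killedStepRev_iterate_add hA (measurable_killingRev hA),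
      killingRev_add_killedStepRev_one hA, ih]

/-- The time-reversed walk leaves `A` almost surely, stated as a Liouville property. -/
def LeavesAlmostSurely (μ : Measure ℝ) (A : Set ℝ) : Prop :=
  ∀ f : ℝ → ℝ≥0∞, (∀ x, f x ≤ 1) → (∀ x ∉ A, f x = 0) → (∀ x ∈ A, f x ≤ ∫⁻ z, f (x - z) ∂μ) →
    ∀ x, f x = 0

theorem antitone_killedStepRev_iterate [IsProbabilityMeasure μ] (hA : MeasurableSet A) :
    Antitone fun n => (killedStepRev μ A)^[n] 1 := by
  refine monotone_killedStepRev.antitone_iterate_of_map_le ?_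
  calc killedStepRev μ A 1 ≤ killingRev μ A + killedStepRev μ A 1 := le_add_self
    _ = 1 := killingRev_add_killedStepRev_one hA

/-- The infimum `h` is the probability of surviving forever. A surviving reversed walk can never go
from `Aᶜ` to `A`, so it would have to stay in `Aᶜ` once there, or stay in `A` forever; the two
hypotheses exclude these in turn. -/
theorem iInf_killedStepRev_iterate [IsProbabilityMeasure μ] (hA : MeasurableSet A)
    (h1 : LeavesAlmostSurely μ A) (h2 : LeavesAlmostSurely μ Aᶜ) (x : ℝ) :
    ⨅ n, (killedStepRev μ A)^[n] 1 x = 0 := by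
  classical
  have hanti := antitone_killedStepRev_iterate (μ := μ) hA
  have hmeas := fun n => measurable_killedStepRev_iterate (μ := μ) hA measurable_one n
  set u : ℕ → ℝ → ℝ≥0∞ := fun n => (killedStepRev μ A)^[n] 1 with hu
  let h : ℝ → ℝ≥0∞ := fun x => ⨅ n, u n x
  have hle1 : ∀ x, h x ≤ 1 := fun x => iInf_le (fun n => u n x) 0
  have hsub : ∀ x, h x ≤ killedStepRev μ A h x := by
    intro x
    have e : killedStepRev μ A h x = ⨅ n, killedStepRev μ A (u n) x := by
      simp only [killedStepRev]
      rw [← lintegral_iInf]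
      · refine lintegral_congr fun z => ?_
        by_cases hz : x - z ∈ A ∧ x ∉ A
        · simp [hz]
        · simp only [if_neg hz]; rfl
      · exact fun n => (measurable_killedStepRev_integrand hA (hmeas n)).comp
          (measurable_prodMk_left (x := x))
      · intro m n hmn z
        dsimp only
        split_ifs
        exacts [le_rfl, hanti hmn _]
      · refine ((lintegral_mono (g := fun _ => 1) fun z => ?_).trans_lt (by simp)).ne
        dsimp only
        split_ifs
        exacts [zero_le, le_rfl]
    rw [e]
    refine le_iInf fun n => ?_
    have : u (n + 1) = killedStepRev μ A (u n) := by
      simp only [hu, Function.iterate_succ_apply']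
    rw [← this]
    exact iInf_le (fun n => u n x) (n + 1)
  have hoff : ∀ x ∉ A, h x = 0 := by
    intro x hx
    -- From a point of `Aᶜ`, jumps into `A` are killed, so replacing `h` by 0 on `A` preserves the
    -- subharmonic inequality there.
    have := h2 (Aᶜ.indicator h) (fun x => (indicator_le_self _ _ x).trans (hle1 x))
      (fun x hx => indicator_of_notMem hx _) (fun y hy => by
        rw [indicator_of_mem hy]
        refine (hsub y).trans (lintegral_mono fun z => ?_)
        by_cases hz : y - z ∈ A
        · simp [hz, show y ∉ A from hy]
        · simp [hz]) x
    rwa [indicator_of_mem (show x ∈ Aᶜ from hx)] at this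
  refine h1 h hle1 hoff (fun y hy => (hsub y).trans (lintegral_mono fun z => ?_)) x
  simp [hy]

theorem tsum_killedStepRev_iterate [IsProbabilityMeasure μ] (hA : MeasurableSet A)
    (h1 : LeavesAlmostSurely μ A) (h2 : LeavesAlmostSurely μ Aᶜ) (x : ℝ) :
    ∑' i, (killedStepRev μ A)^[i] (killingRev μ A) x = 1 := by
  have hlim : Tendsto (fun n => (killedStepRev μ A)^[n] 1 x) atTop (𝓝 0) := by
    rw [← iInf_killedStepRev_iterate hA h1 h2 x]
    exact tendsto_atTop_iInf fun m n hmn => antitone_killedStepRev_iterate hA hmn x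
  have hsum := (ENNReal.tendsto_nat_tsum
    fun i => (killedStepRev μ A)^[i] (killingRev μ A) x).add hlim
  have hconst : ∀ n, (∑ i ∈ Finset.range n, (killedStepRev μ A)^[i] (killingRev μ A) x) +
      (killedStepRev μ A)^[n] 1 x = 1 := fun n => by
    have := congrFun (sum_killedStepRev_iterate_add (μ := μ) hA n) x
    simpa using this
  simp only [hconst, add_zero] at hsum
  exact tendsto_nhds_unique hsum tendsto_const_nhds |>.symm ▸ rfl

theorem lintegral_mul_killedStep [SFinite μ] (hA : MeasurableSet A) {lam : Measure ℝ} [SFinite lam]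
    (hlam : ∀ᵐ z ∂μ, ∀ f : ℝ → ℝ≥0∞, Measurable f → ∫⁻ x, f (x + z) ∂lam = ∫⁻ x, f x ∂lam)
    {f g : ℝ → ℝ≥0∞} (hf : Measurable f) (hg : Measurable g) :
    ∫⁻ x, f x * killedStep μ A g x ∂lam = ∫⁻ x, killedStepRev μ A f x * g x ∂lam := by
  classical
  have m1 := measurable_killedStep_integrand hA hg
  have m2 := measurable_killedStepRev_integrand hA hf
  calc ∫⁻ x, f x * killedStep μ A g x ∂lam
      = ∫⁻ x, ∫⁻ z, f x * (if x ∈ A ∧ x + z ∉ A then 0 else g (x + z)) ∂μ ∂lam :=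
        lintegral_congr fun x =>
          (lintegral_const_mul _ (m1.comp (measurable_prodMk_left (x := x)))).symm
    _ = ∫⁻ z, ∫⁻ x, f x * (if x ∈ A ∧ x + z ∉ A then 0 else g (x + z)) ∂lam ∂μ :=
        lintegral_lintegral_swap ((hf.comp measurable_fst).mul m1).aemeasurable
    _ = ∫⁻ z, ∫⁻ x, (if x - z ∈ A ∧ x ∉ A then 0 else f (x - z)) * g x ∂lam ∂μ := by
        refine lintegral_congr_ae ?_
        filter_upwards [hlam] with z hz
        -- Invariance of `lam` under the shift by `z` exchanges the roles of the start and the end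
        -- of the jump.
        refine Eq.trans ?_ (hz _ ((m2.comp (measurable_prodMk_right (y := z))).mul hg))
        refine lintegral_congr fun x => ?_
        simp only [add_sub_cancel_right]
        split_ifs <;> simp
    _ = ∫⁻ x, ∫⁻ z, (if x - z ∈ A ∧ x ∉ A then 0 else f (x - z)) * g x ∂μ ∂lam :=
        (lintegral_lintegral_swap (m2.mul (hg.comp measurable_fst)).aemeasurable).symm
    _ = ∫⁻ x, killedStepRev μ A f x * g x ∂lam :=
        lintegral_congr fun x =>
          lintegral_mul_const _ (m2.comp (measurable_prodMk_left (x := x)))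

theorem lintegral_mul_killedStep_iterate [SFinite μ] (hA : MeasurableSet A) {lam : Measure ℝ}
    [SFinite lam]
    (hlam : ∀ᵐ z ∂μ, ∀ f : ℝ → ℝ≥0∞, Measurable f → ∫⁻ x, f (x + z) ∂lam = ∫⁻ x, f x ∂lam)
    {f g : ℝ → ℝ≥0∞} (hf : Measurable f) (hg : Measurable g) (n : ℕ) :
    ∫⁻ x, f x * (killedStep μ A)^[n] g x ∂lam = ∫⁻ x, (killedStepRev μ A)^[n] f x * g x ∂lam := by
  induction n generalizing g with
  | zero => rfl
  | succ n ih =>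
    rw [Function.iterate_succ_apply, ih (measurable_killedStep hA hg),
      lintegral_mul_killedStep hA hlam (measurable_killedStepRev_iterate hA hf n) hg,
      Function.iterate_succ_apply']

/-- Summing over the lifetime of the killed walk started from `killingRev μ A • lam` recovers the
invariant measure `lam`. -/
theorem tsum_lintegral_killedStep_iterate [IsProbabilityMeasure μ] (hA : MeasurableSet A)
    (h1 : LeavesAlmostSurely μ A) (h2 : LeavesAlmostSurely μ Aᶜ) {lam : Measure ℝ} [SFinite lam]
    (hlam : ∀ᵐ z ∂μ, ∀ f : ℝ → ℝ≥0∞, Measurable f → ∫⁻ x, f (x + z) ∂lam = ∫⁻ x, f x ∂lam)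
    {g : ℝ → ℝ≥0∞} (hg : Measurable g) :
    ∑' i, ∫⁻ x, (killedStep μ A)^[i] g x ∂(lam.withDensity (killingRev μ A)) =
      ∫⁻ x, g x ∂lam := by
  have hp := measurable_killingRev (μ := μ) hA
  have : ∀ i, ∫⁻ x, (killedStep μ A)^[i] g x ∂(lam.withDensity (killingRev μ A)) =
      ∫⁻ x, (killedStepRev μ A)^[i] (killingRev μ A) x * g x ∂lam := fun i => by
    rw [lintegral_withDensity_eq_lintegral_mul _ hp (measurable_killedStep_iterate hA hg i)]
    exact lintegral_mul_killedStep_iterate hA hlam hp hg i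
  simp only [this]
  rw [← lintegral_tsum (f := fun i x => (killedStepRev μ A)^[i] (killingRev μ A) x * g x)
    fun i => ((measurable_killedStepRev_iterate hA hp i).mul hg).aemeasurable]
  refine lintegral_congr fun x => ?_
  rw [ENNReal.tsum_mul_right, tsum_killedStepRev_iterate hA h1 h2, one_mul]

end Operators

/-! ### Half-lines are left almost surely -/

theorem leavesAlmostSurely_Iio {μ : Measure ℝ} [IsProbabilityMeasure μ]
    (hnd : μ ≠ Measure.dirac 0) (hint : Integrable (fun x : ℝ => x) μ) (hmean : ∫ x, x ∂μ = 0) :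
    LeavesAlmostSurely μ (Iio 0) := by
  intro f hf1 hf0 hsub x
  have := eq_zero_of_le_step hnd hint hmean (f := fun x => f (-x)) (fun x => hf1 _)
    (fun x hx => hf0 _ (by simp; linarith)) (fun x => by
      by_cases hx : -x ∈ Iio (0 : ℝ)
      · refine (hsub _ hx).trans (le_of_eq (lintegral_congr fun z => ?_))
        congr 1
        ring
      · rw [hf0 _ hx]
        exact zero_le) (-x)
  simpa using this

/-- Here `f` already vanishes on the negative half-line, so the increment law is reflected instead
of the function; the reflected law is again centred and non-degenerate. -/
theorem leavesAlmostSurely_Ici {μ : Measure ℝ} [IsProbabilityMeasure μ]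
    (hnd : μ ≠ Measure.dirac 0) (hint : Integrable (fun x : ℝ => x) μ) (hmean : ∫ x, x ∂μ = 0) :
    LeavesAlmostSurely μ (Ici 0) := by
  have hneg : Measurable fun x : ℝ => -x := measurable_neg
  have : IsProbabilityMeasure (μ.map fun x : ℝ => -x) :=
    Measure.isProbabilityMeasure_map hneg.aemeasurable
  intro f hf1 hf0 hsub
  refine eq_zero_of_le_step (ν := μ.map fun x : ℝ => -x) ?_ ?_ ?_ hf1
    (fun x hx => hf0 x (by simpa using hx)) (fun x => ?_)
  · intro h
    apply hnd
    have h' := congrArg (Measure.map fun x : ℝ => -x) h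
    rw [Measure.map_map hneg hneg, Measure.map_dirac] at h'
    simpa [Function.comp_def] using h'
  · rw [integrable_map_measure (by fun_prop) hneg.aemeasurable]
    exact hint.neg
  · rw [integral_map hneg.aemeasurable (by fun_prop), integral_neg, hmean, neg_zero]
  · by_cases hx : x ∈ Ici (0 : ℝ)
    · refine (hsub x hx).trans (le_of_eq ?_)
      have : (μ.map fun x : ℝ => -x) = μ.map (MeasurableEquiv.neg ℝ) := rfl
      rw [this, lintegral_map_equiv]
      rfl
    · rw [hf0 _ hx]
      exact zero_le

/-! ### Crossing times and the Markov property -/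

/-- The trajectory `s` does not jump from `A` to `Aᶜ` in its first `i` steps. -/
def NoExit (A : Set ℝ) (s : ℕ → ℝ) (i : ℕ) : Prop := ∀ k < i, ¬ (s k ∈ A ∧ s (k + 1) ∉ A)

theorem measurableSet_noExit {A : Set ℝ} (hA : MeasurableSet A) (i : ℕ) :
    MeasurableSet {s : ℕ → ℝ | NoExit A s i} := by
  simp only [NoExit, ofPred_forall]
  refine MeasurableSet.iInter fun k => MeasurableSet.iInter fun _ => ?_
  exact ((measurable_pi_apply k hA).inter (measurable_pi_apply (k + 1) hA).compl).compl

/-- A time `k + 1` labels the step from `k` to `k + 1`. Hence the crossing step itself, `i = T - 1`,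
still satisfies `i < T` and is counted. -/
theorem lt_iInf_iff_forall {p : ℕ → Prop} (i : ℕ) :
    (i : ℕ∞) < ⨅ (k : ℕ) (_ : 1 ≤ k ∧ p k), (k : ℕ∞) ↔ ∀ k < i, ¬ p (k + 1) := by
  constructor
  · intro h k hk hp
    have : (⨅ (k : ℕ) (_ : 1 ≤ k ∧ p k), (k : ℕ∞)) ≤ ((k + 1 : ℕ) : ℕ∞) :=
      iInf₂_le (k + 1) ⟨by omega, hp⟩
    have h2 := h.trans_le this
    have h3 : i < k + 1 := by exact_mod_cast h2
    omega
  · intro h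
    have h1 : ((i + 1 : ℕ) : ℕ∞) ≤ ⨅ (k : ℕ) (_ : 1 ≤ k ∧ p k), (k : ℕ∞) := by
      refine le_iInf₂ fun k hk => ?_
      by_contra! hlt
      have h3 : k < i + 1 := by exact_mod_cast hlt
      refine h (k - 1) (by omega) ?_
      rw [Nat.sub_add_cancel hk.1]
      exact hk.2
    refine lt_of_lt_of_le ?_ h1
    exact_mod_cast Nat.lt_succ_self i

theorem lt_firstUp_iff (s : ℕ → ℝ) (i : ℕ) : (i : ℕ∞) < firstUp s ↔ NoExit (Iio 0) s i := by
  rw [firstUp, lt_iInf_iff_forall]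
  simp [NoExit]

theorem lt_firstDown_iff (s : ℕ → ℝ) (i : ℕ) : (i : ℕ∞) < firstDown s ↔ NoExit (Ici 0) s i := by
  rw [firstDown, lt_iInf_iff_forall]
  simp [NoExit]

theorem sum_startAndIncrements {Ω : Type*} (S : ℕ → Ω → ℝ) (n : ℕ) (ω : Ω) :
    ∑ j ∈ Finset.range (n + 1), startAndIncrements S j ω = S n ω := by
  induction n with
  | zero => simp [startAndIncrements]
  | succ n ih => rw [Finset.sum_range_succ, ih]; simp [startAndIncrements]

section Walk

variable {Ω : Type*} [MeasurableSpace Ω] {P : Measure Ω} {S : ℕ → Ω → ℝ} {μ : Measure ℝ}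

theorem IsRandomWalk.measurable_startAndIncrements (hS : IsRandomWalk P S μ) (n : ℕ) :
    Measurable (startAndIncrements S n) := by
  cases n with
  | zero => exact hS.measurable 0
  | succ n => exact (hS.measurable (n + 1)).sub (hS.measurable n)

theorem IsRandomWalk.measurable_stopped (hS : IsRandomWalk P S μ) (i : ℕ) :
    Measurable fun ω n => S (min n i) ω :=
  measurable_pi_lambda _ fun n => hS.measurable (min n i)

/-- The path stopped at time `i` is a measurable function of the starting point and the first `i`
increments. Stopping keeps the past in the fixed space `ℕ → ℝ`. -/
theorem IsRandomWalk.indepFun_stopped (hS : IsRandomWalk P S μ) (i : ℕ) :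
    IndepFun (fun ω n => S (min n i) ω) (startAndIncrements S (i + 1)) P := by
  have h := hS.indep.indepFun_finset (Finset.range (i + 1)) {i + 1} (by simp)
    hS.measurable_startAndIncrements
  let φ : (Finset.range (i + 1) → ℝ) → ℕ → ℝ := fun y n =>
    ∑ j ∈ Finset.range (min n i + 1), if hj : j ∈ Finset.range (i + 1) then y ⟨j, hj⟩ else 0
  have hφ : Measurable φ := by
    refine measurable_pi_lambda _ fun n => Finset.measurable_sum _ fun j _ => ?_
    by_cases hj : j ∈ Finset.range (i + 1)
    · simp only [dif_pos hj]
      exact measurable_pi_apply _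
    · simp only [dif_neg hj]
      exact measurable_const
  have h' := h.comp hφ (measurable_pi_apply (⟨i + 1, by simp⟩ : ({i + 1} : Finset ℕ)))
  suffices hφV : (fun ω n => S (min n i) ω) =
      φ ∘ fun ω (j : Finset.range (i + 1)) => startAndIncrements S j ω by
    rw [hφV]
    exact h'
  ext ω n
  simp only [Function.comp, φ]
  rw [← sum_startAndIncrements S]
  refine Finset.sum_congr rfl fun j hj => ?_
  have : j ∈ Finset.range (i + 1) := by
    simp only [Finset.mem_range] at hj ⊢
    omega
  rw [dif_pos this]

theorem IsRandomWalk.lintegral_increment [IsProbabilityMeasure P] (hS : IsRandomWalk P S μ) (i : ℕ)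
    {Φ : (ℕ → ℝ) × ℝ → ℝ≥0∞} (hΦ : Measurable Φ) :
    ∫⁻ ω, Φ (fun n => S (min n i) ω, S (i + 1) ω - S i ω) ∂P =
      ∫⁻ ω, ∫⁻ z, Φ (fun n => S (min n i) ω, z) ∂μ ∂P := by
  have hV := hS.measurable_stopped i
  have hY := hS.measurable_startAndIncrements (i + 1)
  have hμ : IsProbabilityMeasure μ := by
    rw [← hS.law i]
    exact Measure.isProbabilityMeasure_map hY.aemeasurable
  have h := (indepFun_iff_map_prod_eq_prod_map_map hV.aemeasurable hY.aemeasurable).1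
    (hS.indepFun_stopped i)
  rw [hS.law i] at h
  have hV' : IsProbabilityMeasure (P.map fun ω n => S (min n i) ω) :=
    Measure.isProbabilityMeasure_map hV.aemeasurable
  calc ∫⁻ ω, Φ (fun n => S (min n i) ω, S (i + 1) ω - S i ω) ∂P
      = ∫⁻ p, Φ p ∂(P.map fun ω => (fun n => S (min n i) ω, startAndIncrements S (i + 1) ω)) :=
        (lintegral_map hΦ (hV.prodMk hY)).symm
    _ = _ := by
        rw [h, lintegral_prod _ hΦ.aemeasurable, lintegral_map hΦ.lintegral_prod_right' hV]

open Classical in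
theorem IsRandomWalk.lintegral_noExit_pair [IsProbabilityMeasure P] (hS : IsRandomWalk P S μ)
    {A : Set ℝ} (hA : MeasurableSet A) (i : ℕ) {F : ℝ → ℝ → ℝ≥0∞}
    (hF : Measurable (Function.uncurry F)) :
    ∫⁻ ω, (if NoExit A (fun n => S n ω) i then F (S i ω) (S (i + 1) ω) else 0) ∂P =
      ∫⁻ ω, (if NoExit A (fun n => S n ω) i then ∫⁻ z, F (S i ω) (S i ω + z) ∂μ else 0) ∂P := by
  have hpath : ∀ ω, NoExit A (fun n => S (min n i) ω) i ↔ NoExit A (fun n => S n ω) i := by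
    intro ω
    refine forall₂_congr fun k hk => ?_
    dsimp only
    rw [min_eq_left hk.le, min_eq_left (Nat.succ_le_of_lt hk)]
  have h := hS.lintegral_increment i (Φ := fun p => if NoExit A p.1 i then
    F (p.1 i) (p.1 i + p.2) else 0) (Measurable.ite (measurable_fst (measurableSet_noExit hA i))
      (hF.comp (by fun_prop : Measurable fun p : (ℕ → ℝ) × ℝ => (p.1 i, p.1 i + p.2)))
      measurable_const)
  simp only [hpath, min_self, add_sub_cancel] at h
  rw [h]
  refine lintegral_congr fun ω => ?_
  split_ifs
  · rfl
  · simp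

-- Markov property, by induction on `i`: conditioning on the past before the last step replaces `g`
-- by `killedStep μ A g`.
open Classical in
theorem IsRandomWalk.lintegral_noExit [IsProbabilityMeasure P] [IsProbabilityMeasure μ]
    (hS : IsRandomWalk P S μ) {A : Set ℝ} (hA : MeasurableSet A) (i : ℕ) {g : ℝ → ℝ≥0∞}
    (hg : Measurable g) :
    ∫⁻ ω, (if NoExit A (fun n => S n ω) i then g (S i ω) else 0) ∂P =
      ∫⁻ x, (killedStep μ A)^[i] g x ∂(P.map (S 0)) := by
  induction i generalizing g with
  | zero =>
    rw [Function.iterate_zero, id, lintegral_map hg (hS.measurable 0)]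
    simp [NoExit]
  | succ i ih =>
    rw [Function.iterate_succ_apply, ← ih (measurable_killedStep hA hg)]
    have hF : Measurable (Function.uncurry fun x y => if x ∈ A ∧ y ∉ A then 0 else g y) :=
      Measurable.ite ((measurable_fst hA).inter (measurable_snd hA).compl) measurable_const
        (hg.comp measurable_snd)
    have h := hS.lintegral_noExit_pair hA i hF
    refine Eq.trans (lintegral_congr fun ω => ?_) h
    have : NoExit A (fun n => S n ω) (i + 1) ↔
        NoExit A (fun n => S n ω) i ∧ ¬ (S i ω ∈ A ∧ S (i + 1) ω ∉ A) := by
      simp only [NoExit, Nat.lt_succ_iff_lt_or_eq]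
      constructor
      · exact fun h => ⟨fun k hk => h k (Or.inl hk), h i (Or.inr rfl)⟩
      · rintro ⟨h, h'⟩ k (hk | rfl)
        exacts [h k hk, h']
    rw [if_congr this rfl rfl]
    by_cases h1 : NoExit A (fun n => S n ω) i <;> by_cases h2 : S i ω ∈ A ∧ S (i + 1) ω ∉ A <;>
      simp [h1, h2]

open Classical in
/-- The expected number of jumps from `B` to `Bᶜ` until the first jump from `A` to `Aᶜ`, for the
walk started from the normalized entrance law into `Aᶜ`. -/
theorem IsRandomWalk.lintegral_tsum_noExit [IsProbabilityMeasure P] [IsProbabilityMeasure μ]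
    (hS : IsRandomWalk P S μ) {A B : Set ℝ} (hA : MeasurableSet A) (hB : MeasurableSet B)
    (h1 : LeavesAlmostSurely μ A) (h2 : LeavesAlmostSurely μ Aᶜ) {lam : Measure ℝ} [SFinite lam]
    (hlam : ∀ᵐ z ∂μ, ∀ f : ℝ → ℝ≥0∞, Measurable f → ∫⁻ x, f (x + z) ∂lam = ∫⁻ x, f x ∂lam)
    {c : ℝ≥0∞} (hlaw : P.map (S 0) = c • lam.withDensity (killingRev μ A)) :
    ∫⁻ ω, ∑' i, (if NoExit A (fun n => S n ω) i ∧ S i ω ∈ B ∧ S (i + 1) ω ∉ B then 1 else 0) ∂P =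
      c * ∫⁻ z, lam {x | x ∈ B ∧ x + z ∉ B} ∂μ := by
  let F : ℝ → ℝ → ℝ≥0∞ := fun x y => if x ∈ B ∧ y ∉ B then 1 else 0
  have hF : Measurable (Function.uncurry F) :=
    Measurable.ite ((measurable_fst hB).inter (measurable_snd hB).compl) measurable_const
      measurable_const
  have hF' : Measurable fun p : ℝ × ℝ => F p.1 (p.1 + p.2) :=
    hF.comp (by fun_prop : Measurable fun p : ℝ × ℝ => (p.1, p.1 + p.2))
  have hg : Measurable fun x => ∫⁻ z, F x (x + z) ∂μ := hF'.lintegral_prod_right'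
  have hpath : Measurable fun ω n => S n ω := measurable_pi_lambda _ hS.measurable
  have hterm : ∀ i ω, (if NoExit A (fun n => S n ω) i ∧ S i ω ∈ B ∧ S (i + 1) ω ∉ B
      then (1 : ℝ≥0∞) else 0) =
      if NoExit A (fun n => S n ω) i then F (S i ω) (S (i + 1) ω) else 0 := fun i ω => by
    rw [ite_and]
  simp only [hterm]
  have hterm_meas : ∀ i, Measurable fun ω =>
      if NoExit A (fun n => S n ω) i then F (S i ω) (S (i + 1) ω) else 0 := fun i =>
    Measurable.ite (hpath (measurableSet_noExit hA i))
      (hF.comp ((hS.measurable i).prodMk (hS.measurable (i + 1)))) measurable_const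
  rw [lintegral_tsum fun i => (hterm_meas i).aemeasurable]
  simp only [hS.lintegral_noExit_pair hA _ hF]
  simp only [hS.lintegral_noExit hA _ hg, hlaw, lintegral_smul_measure, smul_eq_mul]
  rw [ENNReal.tsum_mul_left, tsum_lintegral_killedStep_iterate hA h1 h2 hlam hg,
    lintegral_lintegral_swap hF'.aemeasurable]
  congr 1
  refine lintegral_congr fun z => ?_
  rw [← lintegral_indicator_one]
  · refine lintegral_congr fun x => ?_
    simp [F, indicator_apply]
  · exact hB.inter ((measurable_add_const z) hB).compl

end Walk

/-! ### Entrance laws and one-step flows -/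

section Law

variable {μ : Measure ℝ}

theorem piPlus_eq_withDensity (μ : Measure ℝ) [IsProbabilityMeasure μ] :
    piPlus μ = (haar (stateSpace μ)).withDensity (killingRev μ (Iio 0)) := by
  classical
  rw [piPlus, ← withDensity_indicator measurableSet_Ici]
  congr 1
  ext x
  rw [killingRev]
  by_cases hx : 0 ≤ x
  · rw [indicator_of_mem (show x ∈ Ici (0 : ℝ) from hx), ← prob_compl_eq_one_sub measurableSet_Iic,
      compl_Iic, ← lintegral_indicator_one measurableSet_Ioi]
    refine lintegral_congr fun z => ?_
    simp [indicator_apply, hx]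
  · rw [indicator_of_notMem (show x ∉ Ici (0 : ℝ) from hx)]
    simp [not_le.1 hx]

theorem piMinus_eq_withDensity (μ : Measure ℝ) [IsProbabilityMeasure μ] :
    piMinus μ = (haar (stateSpace μ)).withDensity (killingRev μ (Ici 0)) := by
  classical
  rw [piMinus, ← withDensity_indicator measurableSet_Iio]
  congr 1
  ext x
  rw [killingRev]
  by_cases hx : x < 0
  · rw [indicator_of_mem (show x ∈ Iio (0 : ℝ) from hx), ← prob_compl_eq_one_sub measurableSet_Ioi,
      compl_Ioi, ← lintegral_indicator_one measurableSet_Iic]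
    refine lintegral_congr fun z => ?_
    simp [indicator_apply, hx]
  · rw [indicator_of_notMem (show x ∉ Iio (0 : ℝ) from hx)]
    simp [not_lt.1 hx]

theorem withDensity_killingRev_univ [SFinite μ] {A : Set ℝ} (hA : MeasurableSet A) (lam : Measure ℝ)
    [SFinite lam] :
    lam.withDensity (killingRev μ A) univ = ∫⁻ z, lam {x | x - z ∈ A ∧ x ∉ A} ∂μ := by
  classical
  rw [withDensity_apply _ MeasurableSet.univ, Measure.restrict_univ]
  simp only [killingRev]
  rw [lintegral_lintegral_swap (Measurable.ite (measurableSet_killing hA) measurable_const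
    measurable_const).aemeasurable]
  refine lintegral_congr fun z => ?_
  rw [← lintegral_indicator_one]
  · refine lintegral_congr fun x => ?_
    simp [indicator_apply]
  · exact ((measurable_sub_const z) hA).inter hA.compl

/-- Mean zero gives `𝔼 X⁺ = 𝔼 X⁻ = 𝔼|X| / 2`, and non-degeneracy makes this positive. -/
theorem ofReal_two_div_mul_lintegral_ofReal [IsProbabilityMeasure μ]
    (hnondeg : μ ≠ Measure.dirac 0) (hint : Integrable (fun x : ℝ => x) μ) (hmean : ∫ x, x ∂μ = 0) :
    ENNReal.ofReal (2 / ∫ x, |x| ∂μ) * ∫⁻ x, ENNReal.ofReal x ∂μ = 1 ∧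
      ENNReal.ofReal (2 / ∫ x, |x| ∂μ) * ∫⁻ x, ENNReal.ofReal (-x) ∂μ = 1 := by
  have hp : Integrable (fun x : ℝ => max x 0) μ := hint.pos_part
  have hn : Integrable (fun x : ℝ => max (-x) 0) μ := hint.neg_part
  have hsum : ∫ x, |x| ∂μ = (∫ x, max x 0 ∂μ) + ∫ x, max (-x) 0 ∂μ := by
    rw [← integral_add hp hn]
    refine integral_congr_ae (ae_of_all _ fun x => ?_)
    rcases le_total 0 x with h | h
    · simp [h, abs_of_nonneg h]
    · simp [h, abs_of_nonpos h]
  have hdiff : (∫ x, max x 0 ∂μ) - ∫ x, max (-x) 0 ∂μ = 0 := by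
    rw [← integral_sub hp hn]
    refine Eq.trans ?_ hmean
    refine integral_congr_ae (ae_of_all _ fun x => ?_)
    rcases le_total 0 x with h | h
    · simp [h]
    · simp [h]
  have hpos : 0 < ∫ x, max x 0 ∂μ := by
    obtain ⟨δ, hδ, hμ⟩ := exists_pos_measure_Ici μ hnondeg hint hmean
    rw [integral_pos_iff_support_of_nonneg (f := fun x : ℝ => max x 0)
      (fun x => le_max_right _ _) hp]
    refine hμ.trans_le (measure_mono fun x hx => ?_)
    have : 0 < x := hδ.trans_le hx
    simp [this]
  have e1 : ∫⁻ x, ENNReal.ofReal x ∂μ = ENNReal.ofReal (∫ x, max x 0 ∂μ) := by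
    rw [ofReal_integral_eq_lintegral_ofReal hp (ae_of_all _ fun x => le_max_right _ _)]
    simp
  have e2 : ∫⁻ x, ENNReal.ofReal (-x) ∂μ = ENNReal.ofReal (∫ x, max (-x) 0 ∂μ) := by
    rw [ofReal_integral_eq_lintegral_ofReal hn (ae_of_all _ fun x => le_max_right _ _)]
    simp
  have hne : (∫ x, max x 0 ∂μ) ≠ 0 := hpos.ne'
  have e3 : ∫ x, max (-x) 0 ∂μ = ∫ x, max x 0 ∂μ := by linarith
  rw [e1, e2, hsum, e3, ← ENNReal.ofReal_mul (by positivity)]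
  have : 2 / ((∫ x, max x 0 ∂μ) + ∫ x, max x 0 ∂μ) * ∫ x, max x 0 ∂μ = 1 := by
    field_simp
    norm_num
  simp [this]

theorem lintegral_haar_up {Z : AddSubgroup ℝ} (hZ : ∀ᵐ z ∂μ, z ∈ Z) {a : ℝ} (ha : a ∈ Z) :
    ∫⁻ z, haar Z {x | x ∈ Iio a ∧ x + z ∉ Iio a} ∂μ = ∫⁻ z, ENNReal.ofReal z ∂μ := by
  refine lintegral_congr_ae ?_
  filter_upwards [hZ] with z hz
  have : {x | x ∈ Iio a ∧ x + z ∉ Iio a} = Ico (a - z) a := by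
    ext x
    simp only [mem_ofPred_eq, mem_Iio, not_lt, mem_Ico, sub_le_iff_le_add]
    exact and_comm
  rw [this, haar_Ico (Z.sub_mem ha hz) ha, sub_sub_cancel]

theorem lintegral_haar_down {Z : AddSubgroup ℝ} (hZ : ∀ᵐ z ∂μ, z ∈ Z) {a : ℝ} (ha : a ∈ Z) :
    ∫⁻ z, haar Z {x | x ∈ Ici a ∧ x + z ∉ Ici a} ∂μ = ∫⁻ z, ENNReal.ofReal (-z) ∂μ := by
  refine lintegral_congr_ae ?_
  filter_upwards [hZ] with z hz
  have : {x | x ∈ Ici a ∧ x + z ∉ Ici a} = Ico a (a - z) := by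
    ext x
    simp only [mem_ofPred_eq, mem_Ici, not_le, mem_Ico, lt_sub_iff_add_lt]
  rw [this, haar_Ico ha (Z.sub_mem ha hz)]
  congr 1
  ring

end Law

theorem isProbabilityMeasure_piPlusNorm {μ : Measure ℝ} [IsProbabilityMeasure μ]
    (hnondeg : μ ≠ Measure.dirac 0)
    (hint : Integrable (fun x : ℝ => x) μ) (hmean : ∫ x, x ∂μ = 0) :
    IsProbabilityMeasure (piPlusNorm μ) := by
  constructor
  rw [piPlusNorm, Measure.smul_apply, piPlus_eq_withDensity,
    withDensity_killingRev_univ measurableSet_Iio, smul_eq_mul,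
    ← (ofReal_two_div_mul_lintegral_ofReal hnondeg hint hmean).1]
  congr 1
  refine lintegral_congr_ae ?_
  filter_upwards [ae_mem_stateSpace μ] with z hz
  have : {x | x - z ∈ Iio (0 : ℝ) ∧ x ∉ Iio (0 : ℝ)} = Ico 0 z := by
    ext x
    simp only [mem_ofPred_eq, mem_Iio, not_lt, mem_Ico, sub_neg]
    exact and_comm
  rw [this, haar_Ico (zero_mem _) hz, sub_zero]

theorem isProbabilityMeasure_piMinusNorm {μ : Measure ℝ} [IsProbabilityMeasure μ]
    (hnondeg : μ ≠ Measure.dirac 0)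
    (hint : Integrable (fun x : ℝ => x) μ) (hmean : ∫ x, x ∂μ = 0) :
    IsProbabilityMeasure (piMinusNorm μ) := by
  constructor
  rw [piMinusNorm, Measure.smul_apply, piMinus_eq_withDensity,
    withDensity_killingRev_univ measurableSet_Ici, smul_eq_mul,
    ← (ofReal_two_div_mul_lintegral_ofReal hnondeg hint hmean).2]
  congr 1
  refine lintegral_congr_ae ?_
  filter_upwards [ae_mem_stateSpace μ] with z hz
  have : {x | x - z ∈ Ici (0 : ℝ) ∧ x ∉ Ici (0 : ℝ)} = Ico z 0 := by
    ext x
    simp only [mem_ofPred_eq, mem_Ici, not_le, mem_Ico, sub_nonneg]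
  rw [this, haar_Ico hz (zero_mem _), zero_sub]

/-! ### Expected numbers of crossings -/

section Crossings

variable {Ω : Type*} [MeasurableSpace Ω] {P : Measure Ω} [IsProbabilityMeasure P]
  {S : ℕ → Ω → ℝ} {μ : Measure ℝ} [IsProbabilityMeasure μ]

/-- The stopping set `A` and the counted level `a` are unrelated: killing at exits from `A` only has
to make the occupation measure Haar, whose flow across `a` is the same in both directions. -/
theorem IsRandomWalk.lintegral_crossings (hS : IsRandomWalk P S μ)
    (hnondeg : μ ≠ Measure.dirac 0) (hint : Integrable (fun x : ℝ => x) μ)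
    (hmean : ∫ x, x ∂μ = 0) {a : ℝ} (ha : a ∈ stateSpace μ) {A : Set ℝ} (hA : MeasurableSet A)
    (h1 : LeavesAlmostSurely μ A) (h2 : LeavesAlmostSurely μ Aᶜ)
    (hlaw : P.map (S 0) = ENNReal.ofReal (2 / ∫ x, |x| ∂μ) •
      (haar (stateSpace μ)).withDensity (killingRev μ A))
    {T : (ℕ → ℝ) → ℕ∞} (hT : ∀ s (i : ℕ), (i : ℕ∞) < T s ↔ NoExit A s i) :
    ∫⁻ ω, upCrossings (fun n => S n ω) (T fun n => S n ω) a ∂P = 1 ∧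
      ∫⁻ ω, downCrossings (fun n => S n ω) (T fun n => S n ω) a ∂P = 1 := by
  classical
  have hZ := ae_mem_stateSpace μ
  have hlam : ∀ᵐ z ∂μ, ∀ f : ℝ → ℝ≥0∞, Measurable f →
      ∫⁻ x, f (x + z) ∂(haar (stateSpace μ)) = ∫⁻ x, f x ∂(haar (stateSpace μ)) := by
    filter_upwards [hZ] with z hz f hf
    exact lintegral_haar_add_right hz hf
  obtain ⟨c1, c2⟩ := ofReal_two_div_mul_lintegral_ofReal hnondeg hint hmean
  have hup := hS.lintegral_tsum_noExit hA (measurableSet_Iio (a := a)) h1 h2 hlam hlaw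
  have hdown := hS.lintegral_tsum_noExit hA (measurableSet_Ici (a := a)) h1 h2 hlam hlaw
  rw [lintegral_haar_up hZ ha, c1] at hup
  rw [lintegral_haar_down hZ ha, c2] at hdown
  refine ⟨Eq.trans ?_ hup, Eq.trans ?_ hdown⟩
  · simp [upCrossings, hT]
  · simp [downCrossings, hT]

end Crossings

end LevelCrossing

end

theorem proposition6p2
    -- the law of the increments: non-degenerate, integrable, with mean zero
    (μ : Measure ℝ) [IsProbabilityMeasure μ]
    (hnondeg : μ ≠ Measure.dirac 0)
    (hint : Integrable (fun x : ℝ => x) μ) (hmean : ∫ x, x ∂μ = 0)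
    (a : ℝ) (ha : a ∈ LevelCrossing.stateSpace μ) :
    -- the normalized measures are probability measures
    IsProbabilityMeasure (LevelCrossing.piPlusNorm μ) ∧
    IsProbabilityMeasure (LevelCrossing.piMinusNorm μ) ∧
    ∀ (Ω : Type*) [MeasurableSpace Ω] (P : Measure Ω) [IsProbabilityMeasure P]
      (S : ℕ → Ω → ℝ), LevelCrossing.IsRandomWalk P S μ →
      -- starting under `π₊'`, until the first up-crossing of zero
      (P.map (S 0) = LevelCrossing.piPlusNorm μ →
        ∫⁻ ω, LevelCrossing.upCrossings (fun n => S n ω)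
          (LevelCrossing.firstUp fun n => S n ω) a ∂P = 1 ∧
        ∫⁻ ω, LevelCrossing.downCrossings (fun n => S n ω)
          (LevelCrossing.firstUp fun n => S n ω) a ∂P = 1) ∧
      -- starting under `π₋'`, until the first down-crossing of zero
      (P.map (S 0) = LevelCrossing.piMinusNorm μ →
        ∫⁻ ω, LevelCrossing.upCrossings (fun n => S n ω)
          (LevelCrossing.firstDown fun n => S n ω) a ∂P = 1 ∧
        ∫⁻ ω, LevelCrossing.downCrossings (fun n => S n ω)
          (LevelCrossing.firstDown fun n => S n ω) a ∂P = 1) := by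
  have hI := LevelCrossing.leavesAlmostSurely_Iio hnondeg hint hmean
  have hC := LevelCrossing.leavesAlmostSurely_Ici hnondeg hint hmean
  refine ⟨LevelCrossing.isProbabilityMeasure_piPlusNorm hnondeg hint hmean,
    LevelCrossing.isProbabilityMeasure_piMinusNorm hnondeg hint hmean, ?_⟩
  intro Ω _ P _ S hS
  refine ⟨fun hlaw => ?_, fun hlaw => ?_⟩
  · rw [LevelCrossing.piPlusNorm, LevelCrossing.piPlus_eq_withDensity] at hlaw
    exact hS.lintegral_crossings hnondeg hint hmean ha measurableSet_Iio hI
      (by rwa [compl_Iio]) hlaw LevelCrossing.lt_firstUp_iff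
  · rw [LevelCrossing.piMinusNorm, LevelCrossing.piMinus_eq_withDensity] at hlaw
    exact hS.lintegral_crossings hnondeg hint hmean ha measurableSet_Ici hC
      (by rwa [compl_Ici]) hlaw LevelCrossing.lt_firstDown_iff
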